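/- Let $q$ be a prime power, $t\ge 2$ an integer, $\alpha$ a primitive element of $\mathbb F_{q^t}$ (a generator of $\mathbb F_{q^t}^\times$) and $v$ a positive divisor of $q-1$. Write $[t]_q=(q^t-1)/(q-1)$, $\mathrm{Tr}=\mathrm{Tr}_{\mathbb F_{q^t}/\mathbb F_q}$ and $\omega=\alpha^{[t]_q}$, a primitive element of $\mathbb F_q$; for $x\in\mathbb F_q^\times$ let $\log_\omega x$ be the $i\in\{0,\dots,q-2\}$ with $\omega^i=x$. Let $C=\{c_0,\dots,c_{k-1}\}$ be an ordered set of $k\ge t$ distinct integers in $\{0,\dots,q^t-2\}$. Definitions. An $N\times k$ array over an alphabet of size $w$ is an $\mathrm{OA}_\lambda(s,k,w)$ (where $1\le s\le k$ and $N=\lambda w^s$) if in any $s$ distinct columns every $s$-tuple of symbols appears in exactly $\lambda$ rows. It is a $\mathrm{CA}(N;s,k,w)$ (where $1\le s\le k$ and $w^s\le N$) if in any $s$ distinct columns every $s$-tuple of symbols appears in at least one row. An orthogonal array over $\mathbb F_q$ is called linear here if the set of its rows is a linear subspace of $\mathbb F_q^k$ (rows may be repeated). A $(k,s)$-set over $\mathbb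 F_q$, where $1\le s\le k$, is a set of $k$ vectors every $s$ of which are linearly independent over $\mathbb F_q$. A $d$-flat of $PG(t-1,q)$, the space of one-dimensional $\mathbb F_q$-subspaces $[x]=\mathbb F_q x$ of $\mathbb F_{q^t}$, is the set of points contained in an $\mathbb F_q$-subspace of dimension $d+1$ (the empty set for $d=-1$). The cyclic trace array with a zero row, $\mathcal A_{0}(\alpha,C)$, is the $q^t\times k$ array with entries $\mathrm{Tr}(\alpha^{i+c_j})$ for $0\le i\le q^t-2$ and $0$ for $i=q^t-1$. The cyclic trace array modulo $v$, $\mathcal A(\alpha,C;v)$, is the $v[t]_q\times k$ array over $\{0,\dots,v-1\}$ whose $(i,j)$ entry is $\log_\omega(\mathrm{Tr}(\alpha^{i+c_j}))\bmod v$ if $\mathrm{Tr}(\alpha^{i+c_j})\ne0$, and $0$ otherwise. Theorem. (a) The following are equivalent: 1. $\mathcal A_{0}(\alpha,C)$ is a linear $\mathrm{OA}_q(t-1,k,q)$. 2. $\{\alpha^c: c\in C\}$ is a $(k,t-1)$-set over $\mathbb F_q$. 3. The set of shifted sequences $\{(\mathrm{Tr}(\alpha^{i+c}))_{i=0}^{q^t-2}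 : c\in C\}$ is a $(k,t-1)$-set over $\mathbb F_q$. 4. For all pairwise distinct $b_0,\dots,b_{t-2}\in C$ and all $d_0,\dots,d_{t-2}\in\mathbb F_q$, not all zero, the minimal polynomial of $\alpha$ over $\mathbb F_q$ does not divide $\sum_{j=0}^{t-2}d_jx^{b_j}$. 5. For all pairwise distinct $b_0,\dots,b_{t-2}\in C$, no $(t-3)$-flat of $PG(t-1,q)$ contains all the points $[\alpha^{b_0}],\dots,[\alpha^{b_{t-2}}]$. (b) If these equivalent conditions hold and $$q^{t/2-2}\,(q-tv)\ \ge\ v^{t-1},$$ then $\mathcal A(\alpha,C;v)$ is a $\mathrm{CA}(v[t]_q;\,t,\,k,\,v)$. -/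

import Mathlib

namespace CyclicTrace

/-! ## Orthogonal and covering arrays

An `N × k` array over the alphabet `V` is a `Matrix (Fin N) (Fin k) V`. Sets of columns are sets
of column indices. -/

/-- The number of rows of `A` whose restriction to the set `I` of columns is the tuple `u`. -/
noncomputable def rowCount {V : Type*} {N k : ℕ} (A : Matrix (Fin N) (Fin k) V)
    (I : Finset (Fin k)) (u : I → V) : ℕ :=
  Nat.card {i : Fin N // ∀ j : I, A i j = u j}

/-- The columns in `I` are `lam`-covered: every tuple appears at least `lam` times as a row. -/
def IsCovered {V : Type*} {N k : ℕ} (lam : ℕ) (A : Matrix (Fin N) (Fin k) V)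
    (I : Finset (Fin k)) : Prop :=
  ∀ u : I → V, lam ≤ rowCount A I u

/-- The columns in `I` are uniformly `lam`-covered: every tuple appears exactly `lam` times
as a row. -/
def IsUniformlyCovered {V : Type*} {N k : ℕ} (lam : ℕ) (A : Matrix (Fin N) (Fin k) V)
    (I : Finset (Fin k)) : Prop :=
  ∀ u : I → V, rowCount A I u = lam

/-- `A` is an `OA_lam(t, k, v)`: an orthogonal array of strength `t` and index `lam`. -/
structure IsOrthogonalArray {V : Type*} {N k : ℕ} (lam t v : ℕ)
    (A : Matrix (Fin N) (Fin k) V) : Prop where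
  card_alphabet : Nat.card V = v
  strength_pos : 1 ≤ t
  strength_le : t ≤ k
  card_rows : N = lam * v ^ t
  uniformly_covered : ∀ I : Finset (Fin k), I.card = t → IsUniformlyCovered lam A I

/-- `A` is an `OA_lam(t, k, v)` over the field `F` whose rows form a linear subspace of `F ^ k`
(a vector of this subspace may occur as a row several times). -/
structure IsLinearOrthogonalArray {F : Type*} [Field F] {N k : ℕ} (lam t v : ℕ)
    (A : Matrix (Fin N) (Fin k) F) : Prop extends IsOrthogonalArray lam t v A where
  rows_subspace : ∃ W : Submodule F (Fin k → F), (W : Set (Fin k → F)) = Set.range (fun i j => A i j)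

/-- `A` is a `CA_lam(N; t, k, v)`: a covering array of strength `t` and index `lam`. -/
structure IsCoveringArray {V : Type*} {N k : ℕ} (lam t v : ℕ)
    (A : Matrix (Fin N) (Fin k) V) : Prop where
  card_alphabet : Nat.card V = v
  index_pos : 1 ≤ lam
  strength_pos : 1 ≤ t
  strength_le : t ≤ k
  le_card_rows : lam * v ^ t ≤ N
  covered : ∀ I : Finset (Fin k), I.card = t → IsCovered lam A I

/-! ## `(k, s)`-sets and flats -/

/-- `S` is a `(k, s)`-set over `F`: it has `k` elements and every subset of `S` of size `s` is
linearly independent over `F`. -/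
structure IsIndepSet (F : Type*) {M : Type*} [Field F] [AddCommGroup M] [Module F M]
    (k s : ℕ) (S : Set M) : Prop where
  size_pos : 1 ≤ s
  size_le : s ≤ k
  finite : S.Finite
  card_eq : S.ncard = k
  indep : ∀ T : Finset M, (T : Set M) ⊆ S → T.card = s → LinearIndepOn F id (T : Set M)

/-- `P` is a `d`-flat of the projective space of `M`: the set of points lying in a vector subspace
of dimension `d + 1`. For `d = -1` it is the empty set. -/
def IsFlat (F : Type*) {M : Type*} [Field F] [AddCommGroup M] [Module F M]
    (d : ℤ) (P : Set (Projectivization F M)) : Prop :=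
  ∃ W : Submodule F M, FiniteDimensional F W ∧ (Module.finrank F W : ℤ) = d + 1 ∧
    P = {p | p.submodule ≤ W}

/-! ## Cyclic trace arrays

Here `F` is the field with `q` elements and `K` its extension of degree `t`. -/

/-- `α` is a primitive element of `K`: a generator of the group of nonzero elements. -/
def IsPrimitiveElement {K : Type*} [Field K] (α : Kˣ) : Prop :=
  ∀ x : Kˣ, x ∈ Subgroup.zpowers α

/-- `[t]_q = (q ^ t - 1) / (q - 1)`, an exact division for `2 ≤ q`. -/
def qNumber (q t : ℕ) : ℕ := (q ^ t - 1) / (q - 1)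

/-- The sequence `i ↦ Tr(α ^ i)` over `F`. -/
noncomputable def traceSeq (F : Type*) {K : Type*} [Field F] [Field K] [Algebra F K]
    (α : Kˣ) (i : ℕ) : F :=
  Algebra.trace F K ((α : K) ^ i)

/-- The first `n` terms of the left shift by `j` of the sequence `s`. -/
def leftShift {F : Type*} (n j : ℕ) (s : ℕ → F) : Fin n → F := fun i => s (i + j)

/-- The cyclic trace array of `α` and `C = {c 0, …, c (k-1)}` with a row of zeros appended:
entry `Tr(α ^ (i + c j))` in the rows `i ≤ q ^ t - 2`, and `0` in the last row `i = q ^ t - 1`. -/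
noncomputable def cyclicTraceArrayZero (F : Type*) {K : Type*} [Field F] [Field K] [Algebra F K]
    (q t : ℕ) {k : ℕ} (α : Kˣ) (c : Fin k ↪ ℕ) : Matrix (Fin (q ^ t)) (Fin k) F :=
  Matrix.of fun i j => if (i : ℕ) < q ^ t - 1 then Algebra.trace F K ((α : K) ^ ((i : ℕ) + c j)) else 0

/-- The discrete logarithm of `x` with base `ω`: the least `i ≥ 0` with `ω ^ i = x`. -/
noncomputable def discreteLog {K : Type*} [Field K] (ω x : K) : ℕ := sInf {i : ℕ | ω ^ i = x}

open Classical in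
/-- The cyclic trace array modulo `v` of `α` and `C = {c 0, …, c (k-1)}`. It has `v * [t]_q` rows,
and its entry in row `i` and column `j` is the residue in `{0, …, v - 1}` modulo `v` of the
discrete logarithm of `Tr(α ^ (i + c j))` with base `ω = α ^ [t]_q` if this trace is nonzero,
and `0` otherwise. -/
noncomputable def cyclicTraceArrayMod (F : Type*) {K : Type*} [Field F] [Field K] [Algebra F K]
    (q t v : ℕ) [NeZero v] {k : ℕ} (α : Kˣ) (c : Fin k ↪ ℕ) :
    Matrix (Fin (v * qNumber q t)) (Fin k) (Fin v) :=
  Matrix.of fun i j =>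
    if Algebra.trace F K ((α : K) ^ ((i : ℕ) + c j)) ≠ 0 then
      Fin.ofNat v (discreteLog ((α : K) ^ qNumber q t)
        (algebraMap F K (Algebra.trace F K ((α : K) ^ ((i : ℕ) + c j)))))
    else 0

/-- The point `[α ^ i]` of the projective space of the `F`-vector space `K`. -/
noncomputable def powPoint (F : Type*) {K : Type*} [Field F] [Field K] [Algebra F K]
    (α : Kˣ) (i : ℕ) : Projectivization F K :=
  Projectivization.mk F ((α ^ i : Kˣ) : K) (Units.ne_zero _)

end CyclicTrace

/-! The rows of the array with a zero row are the vectors `(Tr (x * α ^ c j))_j`, with each `x` in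
`K` occurring once. By nondegeneracy of the trace form, `x ↦ (Tr (x * w j))_j` is onto exactly when
the `w j` are independent (`traceEval_surjective_iff`), and then all its fibres have the same size.
This ties the orthogonal array to independence; the other conditions rephrase independence by an
injective linear map, evaluation at `α`, or subspaces.

For covering, let `H` be the subgroup of index `v` in `Fˣ`. A row must have its traces in prescribed
cosets of `H`. If the `t` chosen powers are dependent, their relation has only nonzero coefficients,
and the trace vectors fill the hyperplane it defines. So a linear equation `∑ b i * h i = 0` must be
solved in `H`. Character orthogonality expresses the number of solutions by Gauss periods; bounding
all but two factors pointwise and those two by Parseval gives `exists_sum_mul_mem_eq_zero`. The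
hypothesis on `q` and `v` implies the required size of `H` (`sqrt_pow_mul_lt`). Shifting the row
index by `v * [t]_q` multiplies traces by an element of `H`, so the first `v * [t]_q` rows suffice.
-/

namespace CyclicTrace

/-! ## Gauss periods and linear equations over cosets -/

/-- An additive character turns finite sums into products. -/
lemma map_sum_eq_prod {A M ι : Type*} [AddCommMonoid A] [CommMonoid M] (ψ : AddChar A M)
    (s : Finset ι) (f : ι → A) : ψ (∑ i ∈ s, f i) = ∏ i ∈ s, ψ (f i) := by
  classical
  induction s using Finset.induction_on with
  | empty => simp
  | insert a s ha ih => rw [Finset.sum_insert ha, Finset.prod_insert ha, ψ.map_add_eq_mul, ih]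

section Period

variable {F : Type*} [Field F] [Fintype F]

open Classical in
/-- The Gauss period of the subgroup `H` for the additive character `ψ`, scaled by `x`. -/
noncomputable def gaussPeriod (ψ : AddChar F ℂ) (H : Subgroup Fˣ) (x : F) : ℂ :=
  ∑ h : H, ψ (x * ((h : Fˣ) : F))

lemma gaussPeriod_zero (ψ : AddChar F ℂ) (H : Subgroup Fˣ) :
    gaussPeriod ψ H 0 = Nat.card H := by
  classical
  simp [gaussPeriod]

lemma gaussPeriod_mul_mem (ψ : AddChar F ℂ) (H : Subgroup Fˣ) (x : F) (g : H) :
    gaussPeriod ψ H (x * ((g : Fˣ) : F)) = gaussPeriod ψ H x := by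
  classical
  unfold gaussPeriod
  refine Fintype.sum_equiv (Equiv.mulLeft g) _ _ fun h => ?_
  simp [mul_assoc]

/-- Parseval: after expanding the square, orthogonality of characters leaves only the diagonal `h =
g`. -/
lemma sum_norm_sq_gaussPeriod {ψ : AddChar F ℂ} (hψ : ψ.IsPrimitive) (H : Subgroup Fˣ) :
    ∑ x : F, ‖gaussPeriod ψ H x‖ ^ 2 = Nat.card F * Nat.card H := by
  classical
  have key : ∑ x : F, (gaussPeriod ψ H x * (starRingEnd ℂ) (gaussPeriod ψ H x)) =
      (Nat.card F * Nat.card H : ℂ) := by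
    have h1 : ∀ x : F, gaussPeriod ψ H x * (starRingEnd ℂ) (gaussPeriod ψ H x) =
        ∑ h : H, ∑ g : H, ψ (x * (((h : Fˣ) : F) - ((g : Fˣ) : F))) := by
      intro x
      simp only [gaussPeriod, map_sum, Finset.sum_mul_sum]
      refine Finset.sum_congr rfl fun h _ => Finset.sum_congr rfl fun g _ => ?_
      rw [← AddChar.map_neg_eq_conj, ← AddChar.map_add_eq_mul]
      ring_nf
    simp_rw [h1]
    rw [Finset.sum_comm]
    simp_rw [Finset.sum_comm (s := (Finset.univ : Finset F)), AddChar.sum_mulShift _ hψ, sub_eq_zero]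
    simp_rw [Units.val_inj, SetLike.coe_eq_coe]
    simp [Nat.card_eq_fintype_card, mul_comm]
  have h2 : ∀ x : F, gaussPeriod ψ H x * (starRingEnd ℂ) (gaussPeriod ψ H x) =
      ((‖gaussPeriod ψ H x‖ ^ 2 : ℝ) : ℂ) := fun x => by
    rw [Complex.mul_conj, Complex.normSq_eq_norm_sq]
  simp_rw [h2] at key
  exact_mod_cast key

open Classical in
lemma sum_ne_zero_norm_sq_gaussPeriod {ψ : AddChar F ℂ} (hψ : ψ.IsPrimitive) (H : Subgroup Fˣ) :
    ∑ x : Fˣ, ‖gaussPeriod ψ H x‖ ^ 2 = Nat.card H * (Nat.card F - Nat.card H : ℝ) := by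
  have h := sum_norm_sq_gaussPeriod hψ H
  rw [Fintype.sum_eq_add_sum_subtype_ne _ (0 : F), gaussPeriod_zero] at h
  rw [Fintype.sum_equiv unitsEquivNeZero (fun x : Fˣ => ‖gaussPeriod ψ H x‖ ^ 2)
    (fun x => ‖gaussPeriod ψ H x‖ ^ 2) fun x => by simp]
  simp only [Complex.norm_natCast] at h
  linarith

/-- The period is constant on the coset `x H`, so its squared norm occurs `|H|` times in the sum
over nonzero arguments. -/
lemma norm_sq_gaussPeriod_le {ψ : AddChar F ℂ} (hψ : ψ.IsPrimitive) (H : Subgroup Fˣ) (x : Fˣ) :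
    ‖gaussPeriod ψ H x‖ ^ 2 ≤ Nat.card F - Nat.card H := by
  classical
  have hpos : (0 : ℝ) < Nat.card H := by exact_mod_cast Nat.card_pos
  have h := sum_ne_zero_norm_sq_gaussPeriod hψ H
  have hle : ∑ g : H, ‖gaussPeriod ψ H (x * (g : Fˣ) : Fˣ)‖ ^ 2 ≤
      ∑ y : Fˣ, ‖gaussPeriod ψ H y‖ ^ 2 := by
    rw [← Finset.sum_image (f := fun y : Fˣ => ‖gaussPeriod ψ H y‖ ^ 2)
      (g := fun g : H => x * (g : Fˣ)) (by
        intro a _ b _ hab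
        exact Subtype.ext (mul_left_cancel hab))]
    exact Finset.sum_le_sum_of_subset_of_nonneg (Finset.subset_univ _) fun _ _ _ => by positivity
  simp only [Units.val_mul, gaussPeriod_mul_mem, Finset.sum_const, Finset.card_univ,
    nsmul_eq_mul, ← Nat.card_eq_fintype_card] at hle
  rw [h] at hle
  exact le_of_mul_le_mul_left hle hpos

lemma sum_prod_gaussPeriod {ψ : AddChar F ℂ} (hψ : ψ.IsPrimitive) (H : Subgroup Fˣ)
    {ι : Type*} [Fintype ι] [DecidableEq ι] (b : ι → Fˣ)
    (hne : ∀ h : ι → H, ∑ i, (b i : F) * ((h i : Fˣ) : F) ≠ 0) :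
    ∑ x : F, ∏ i, gaussPeriod ψ H (x * b i) = 0 := by
  classical
  simp only [gaussPeriod, Finset.prod_univ_sum, Fintype.piFinset_univ]
  rw [Finset.sum_comm]
  refine Finset.sum_eq_zero fun h _ => ?_
  have h1 : ∀ x : F, ∏ i, ψ (x * (b i : F) * ((h i : Fˣ) : F)) =
      ψ (x * ∑ i, (b i : F) * ((h i : Fˣ) : F)) := by
    intro x
    rw [Finset.mul_sum, map_sum_eq_prod]
    simp only [mul_assoc]
  simp_rw [h1, AddChar.sum_mulShift _ hψ, if_neg (hne h)]
  simp

lemma exists_isPrimitive : ∃ ψ : AddChar F ℂ, ψ.IsPrimitive := by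
  obtain ⟨ψ, hψ⟩ := AddChar.exists_apply_ne_zero.2 (one_ne_zero (α := F))
  exact ⟨ψ, .of_ne_one fun h => hψ (by simp [h])⟩

/-- A homogeneous linear equation with nonzero coefficients has a solution in a subgroup of the
multiplicative group of a finite field if the subgroup is large enough. -/
theorem exists_sum_mul_mem_eq_zero (H : Subgroup Fˣ) {n : ℕ} (b : Fin (n + 2) → Fˣ)
    (hH : (√(Nat.card F : ℝ)) ^ n * (Nat.card F - Nat.card H : ℝ) < (Nat.card H : ℝ) ^ (n + 1)) :
    ∃ h : Fin (n + 2) → H, ∑ i, (b i : F) * ((h i : Fˣ) : F) = 0 := by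
  classical
  by_contra! hne
  obtain ⟨ψ, hψ⟩ := exists_isPrimitive (F := F)
  have hpos : (0 : ℝ) < Nat.card H := by exact_mod_cast Nat.card_pos
  have h0 := sum_prod_gaussPeriod hψ H b hne
  rw [Fintype.sum_eq_add_sum_subtype_ne _ (0 : F),
    ← Fintype.sum_equiv unitsEquivNeZero (fun x : Fˣ => ∏ i, gaussPeriod ψ H ((x : F) * b i))
    (fun x => ∏ i, gaussPeriod ψ H (x * b i)) fun x => by simp] at h0
  simp only [zero_mul, gaussPeriod_zero, Finset.prod_const, Finset.card_univ, Fintype.card_fin]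
    at h0
  -- Without solutions the term `x = 0`, which is `|H| ^ (n + 2)`, must be cancelled by the others.
  have h1 : (Nat.card H : ℝ) ^ (n + 2) ≤ ∑ x : Fˣ, ‖∏ i, gaussPeriod ψ H ((x : F) * b i)‖ := by
    have := norm_sum_le (Finset.univ : Finset Fˣ) fun x => ∏ i, gaussPeriod ψ H ((x : F) * b i)
    rw [eq_neg_of_add_eq_zero_right h0] at this
    simpa using this
  have hb : ∀ x : Fˣ, ‖gaussPeriod ψ H x‖ ≤ √(Nat.card F : ℝ) := fun x =>
    Real.le_sqrt_of_sq_le ((norm_sq_gaussPeriod_le hψ H x).trans (by linarith))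
  -- Two factors are kept as squares by AM-GM, so that Parseval applies to their sum over `x`.
  have h2 : ∀ x : Fˣ, ‖∏ i, gaussPeriod ψ H ((x : F) * b i)‖ ≤ (√(Nat.card F : ℝ)) ^ n *
      ((‖gaussPeriod ψ H (x * b 0 : Fˣ)‖ ^ 2 + ‖gaussPeriod ψ H (x * b 1 : Fˣ)‖ ^ 2) / 2) := by
    intro x
    simp only [norm_prod, ← Units.val_mul]
    rw [Fin.prod_univ_succ, Fin.prod_univ_succ, ← mul_assoc, mul_comm]
    refine mul_le_mul ?_ ?_ (by positivity) (by positivity)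
    · refine (Finset.prod_le_prod (fun _ _ => by positivity) fun i _ => hb _).trans ?_
      simp
    · have := two_mul_le_add_sq ‖gaussPeriod ψ H (x * b 0 : Fˣ)‖ ‖gaussPeriod ψ H (x * b 1 : Fˣ)‖
      rw [Fin.succ_zero_eq_one]
      linarith
  have h3 : ∀ g : Fˣ, ∑ x : Fˣ, ‖gaussPeriod ψ H (x * g : Fˣ)‖ ^ 2 =
      Nat.card H * (Nat.card F - Nat.card H : ℝ) := fun g => by
    rw [← sum_ne_zero_norm_sq_gaussPeriod hψ H]
    exact Fintype.sum_equiv (Equiv.mulRight g) _ _ fun x => by simp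
  have h4 := h1.trans (Finset.sum_le_sum fun x _ => h2 x)
  rw [← Finset.mul_sum, ← Finset.sum_div, Finset.sum_add_distrib, h3, h3] at h4
  have h5 := mul_lt_mul_of_pos_left hH hpos
  rw [← pow_succ'] at h5
  linarith

end Period

/-! ## Linear independence of all families of a given size -/

section IndepSet

variable {F : Type*} [Field F] {M : Type*} [AddCommGroup M] [Module F M]

lemma isIndepSet_range_iff {k s : ℕ} {f : Fin k → M} (hf : Function.Injective f) :
    IsIndepSet F k s (Set.range f) ↔ 1 ≤ s ∧ s ≤ k ∧
      ∀ I : Finset (Fin k), I.card = s → LinearIndepOn F f (I : Set (Fin k)) := by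
  classical
  constructor
  · rintro ⟨h1, h2, -, -, h⟩
    refine ⟨h1, h2, fun I hI => ?_⟩
    rw [linearIndepOn_iff_image hf.injOn, ← Finset.coe_image]
    refine h _ ?_ ?_
    · simp
    · rw [Finset.card_image_of_injective _ hf, hI]
  · rintro ⟨h1, h2, h⟩
    refine ⟨h1, h2, Set.finite_range f, ?_, fun T hT hc => ?_⟩
    · rw [← Set.image_univ, Set.ncard_image_of_injective _ hf, Set.ncard_univ, Nat.card_fin]
    · obtain ⟨I, -, rfl⟩ := Finset.subset_set_image_iff.1 (by rwa [Set.image_univ] : (T : Set M) ⊆ f '' Set.univ)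
      rw [Finset.coe_image, ← linearIndepOn_iff_image hf.injOn]
      exact h I (by rwa [Finset.card_image_of_injective _ hf] at hc)

lemma forall_linearIndepOn_iff_embedding {k s : ℕ} (f : Fin k → M) :
    (∀ I : Finset (Fin k), I.card = s → LinearIndepOn F f (I : Set (Fin k))) ↔
      ∀ e : Fin s ↪ Fin k, LinearIndependent F fun j => f (e j) := by
  classical
  constructor
  · intro h e
    have := h (Finset.univ.map e) (by simp)
    rw [Finset.coe_map, Finset.coe_univ, Set.image_univ] at this
    exact (linearIndepOn_range_iff e.injective f).1 this
  · intro h I hI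
    have := h (I.orderEmbOfFin hI).toEmbedding
    rw [← Finset.range_orderEmbOfFin I hI]
    exact (linearIndepOn_range_iff (I.orderEmbOfFin hI).injective f).2 this

lemma exists_le_finrank_eq [FiniteDimensional F M] (V : Submodule F M) {s : ℕ}
    (hV : Module.finrank F V ≤ s) (hs : s ≤ Module.finrank F M) :
    ∃ W : Submodule F M, V ≤ W ∧ Module.finrank F W = s := by
  induction s, hV using Nat.le_induction with
  | base => exact ⟨V, le_rfl, rfl⟩
  | succ s _ ih =>
    obtain ⟨W, hVW, hW⟩ := ih (by omega)
    obtain ⟨v, hv⟩ : ∃ v, v ∉ W := by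
      by_contra! h
      rw [(Submodule.eq_top_iff'.2 h : W = ⊤), finrank_top] at hW
      omega
    exact ⟨_, hVW.trans le_sup_left, by rw [Submodule.finrank_sup_span_singleton hv, hW]⟩

/-- Dependent vectors span dimension at most `s`; the span can be enlarged to dimension exactly `s`,
as flats require. -/
lemma not_linearIndepOn_iff_exists_submodule [FiniteDimensional F M] {ι : Type*} (f : ι → M)
    {s : ℕ} (I : Finset ι) (hI : I.card = s + 1) (hs : s ≤ Module.finrank F M) :
    ¬ LinearIndepOn F f (I : Set ι) ↔
      ∃ W : Submodule F M, Module.finrank F W = s ∧ ∀ j ∈ I, f j ∈ W := by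
  classical
  constructor
  · intro h
    have hle : Module.finrank F (Submodule.span F (Set.range fun j : I => f j)) ≤ s := by
      have h1 := finrank_range_le_card (R := F) fun j : I => f j
      rw [Fintype.card_coe, hI] at h1
      refine Nat.le_of_lt_succ (lt_of_le_of_ne h1 fun h2 => h ?_)
      exact linearIndependent_iff_card_eq_finrank_span.2
        ((Fintype.card_coe I).trans (hI.trans h2.symm))
    obtain ⟨W, hW, hr⟩ := exists_le_finrank_eq _ hle hs
    exact ⟨W, hr, fun j hj => hW (Submodule.subset_span ⟨⟨j, hj⟩, rfl⟩)⟩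
  · rintro ⟨W, hW, hf⟩ h
    let g : I → W := fun j => ⟨f j, hf j j.2⟩
    have hg : LinearIndependent F g := LinearIndependent.of_comp W.subtype h
    have := hg.fintype_card_le_finrank
    rw [hW, Fintype.card_coe, hI] at this
    omega

end IndepSet

/-! ## Trace forms -/

section Trace

variable (F : Type*) {K : Type*} [Field F] [Field K] [Algebra F K]

/-- The linear map `x ↦ (Tr (x * w j))_j`. -/
noncomputable def traceEval {ι : Type*} (w : ι → K) : K →ₗ[F] ι → F :=
  LinearMap.pi fun j => Algebra.trace F K ∘ₗ LinearMap.mulRight F (w j)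

@[simp]
lemma traceEval_apply {ι : Type*} (w : ι → K) (x : K) (j : ι) :
    traceEval F w x j = Algebra.trace F K (x * w j) := rfl

variable {F}

lemma sum_mul_trace_mul {ι : Type*} [Fintype ι] (d : ι → F) (w : ι → K) (x : K) :
    ∑ j, d j * Algebra.trace F K (x * w j) = Algebra.trace F K (x * ∑ j, d j • w j) := by
  simp [Finset.mul_sum]

/-- A nonzero functional vanishing on the image would give coefficients whose combination of the `w
j` is trace-orthogonal to all of `K`, hence zero. Conversely, a preimage of a unit vector isolates
one coefficient of a relation. -/
lemma traceEval_surjective_iff [Algebra.IsSeparable F K] [FiniteDimensional F K] {ι : Type*} [Fintype ι]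
    {w : ι → K} : Function.Surjective (traceEval F w) ↔ LinearIndependent F w := by
  classical
  constructor
  · intro h
    rw [Fintype.linearIndependent_iff]
    intro d hd j
    obtain ⟨x, hx⟩ := h (Pi.single j 1)
    have h1 := sum_mul_trace_mul d w x
    simp only [hd, mul_zero, map_zero, ← traceEval_apply, hx] at h1
    simpa [Pi.single_apply] using h1
  · intro h
    by_contra hs
    rw [← LinearMap.range_eq_top] at hs
    obtain ⟨φ, hφ, hle⟩ := Submodule.exists_le_ker_of_lt_top _ (lt_top_iff_ne_top.2 hs)
    have h2 : ∑ j, φ (Pi.single j 1) • w j = 0 := by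
      refine (traceForm_nondegenerate F K).2 _ fun x => ?_
      rw [Algebra.traceForm_apply, ← sum_mul_trace_mul]
      have h3 : φ (traceEval F w x) = 0 := hle ⟨x, rfl⟩
      rw [← Finset.univ_sum_single (traceEval F w x), map_sum] at h3
      rw [← h3]
      refine Finset.sum_congr rfl fun j _ => ?_
      rw [← mul_one (traceEval F w x j), ← smul_eq_mul (traceEval F w x j), Pi.single_smul',
        map_smul, smul_eq_mul, mul_comm, traceEval_apply]
    have h4 := Fintype.linearIndependent_iff.1 h _ h2
    refine hφ (LinearMap.pi_ext' fun j => LinearMap.ext_ring ?_)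
    simpa using h4 j

end Trace

/-! ## Powers of a primitive element -/

section Primitive

variable {F K : Type*} [Field F] [Finite F] [Field K] [Algebra F K] [FiniteDimensional F K]
  {q t : ℕ}

variable (F) in
include F in
lemma orderOf_primitive (hq : Nat.card F = q) (hK : Module.finrank F K = t) {α : Kˣ}
    (hα : IsPrimitiveElement α) : orderOf α = q ^ t - 1 := by
  have : Finite K := Module.finite_of_finite F
  rw [orderOf_eq_card_of_forall_mem_zpowers hα, Nat.card_units,
    Module.natCard_eq_pow_finrank (K := F), hq, hK]

omit [Finite F] in
lemma exists_pow_eq [Finite K] {α : Kˣ} (hα : IsPrimitiveElement α) {x : K} (hx : x ≠ 0) :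
    ∃ n < orderOf α, (α : K) ^ n = x := by
  obtain ⟨n, hn⟩ := mem_powers_iff_mem_zpowers.2 (hα (Units.mk0 x hx))
  refine ⟨n % orderOf α, Nat.mod_lt _ (orderOf_pos α), ?_⟩
  rw [← Units.val_pow_eq_pow_val, pow_mod_orderOf]
  exact congrArg Units.val hn

lemma injective_pow_of_le (hq : Nat.card F = q) (ht : 1 ≤ t) (hK : Module.finrank F K = t) {α : Kˣ}
    (hα : IsPrimitiveElement α) {k : ℕ} (c : Fin k ↪ ℕ) (hc : ∀ j, c j ≤ q ^ t - 2) :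
    Function.Injective fun j => (α : K) ^ c j := by
  have hq2 : 2 ≤ q := hq ▸ Finite.one_lt_card
  have hqt : 2 ≤ q ^ t := hq2.trans (Nat.le_self_pow (by omega) q)
  intro i j hij
  refine c.injective (pow_injOn_Iio_orderOf (x := α) ?_ ?_ (Units.ext (by simpa using hij)))
  all_goals
    rw [orderOf_primitive F hq hK hα]
    have := hc i
    have := hc j
    simp only [Set.mem_Iio]
    omega

/-- The elements of `K` listed as `1, α, α ^ 2, …, 0`. -/
noncomputable def powOrZero (q t : ℕ) (α : Kˣ) (i : Fin (q ^ t)) : K :=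
  if (i : ℕ) < q ^ t - 1 then (α : K) ^ (i : ℕ) else 0

lemma powOrZero_bijective (hq : Nat.card F = q) (hK : Module.finrank F K = t) {α : Kˣ}
    (hα : IsPrimitiveElement α) : Function.Bijective (powOrZero q t α) := by
  have : Finite K := Module.finite_of_finite F
  have hq0 : 0 < q := hq ▸ Nat.card_pos
  have hqt : 0 < q ^ t := by positivity
  refine Function.Surjective.bijective_of_nat_card_le (fun x => ?_) ?_
  · by_cases hx : x = 0
    · exact ⟨⟨q ^ t - 1, by omega⟩, by simp [powOrZero, hx]⟩
    · obtain ⟨n, hn, rfl⟩ := exists_pow_eq hα hx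
      rw [orderOf_primitive F hq hK hα] at hn
      exact ⟨⟨n, by omega⟩, by simp [powOrZero, hn]⟩
  · rw [Nat.card_fin, Module.natCard_eq_pow_finrank (K := F), hq, hK]

omit [Finite F] [FiniteDimensional F K] in
lemma cyclicTraceArrayZero_apply (α : Kˣ) {k : ℕ} (c : Fin k ↪ ℕ) (i : Fin (q ^ t)) (j : Fin k) :
    cyclicTraceArrayZero F q t α c i j =
      traceEval F (fun j => (α : K) ^ c j) (powOrZero q t α i) j := by
  simp only [cyclicTraceArrayZero, Matrix.of_apply, traceEval_apply, powOrZero]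
  split_ifs <;> simp [pow_add]

lemma rowCount_cyclicTraceArrayZero (hq : Nat.card F = q) (hK : Module.finrank F K = t) {α : Kˣ}
    (hα : IsPrimitiveElement α) {k : ℕ} (c : Fin k ↪ ℕ) (I : Finset (Fin k)) (u : I → F) :
    rowCount (cyclicTraceArrayZero F q t α c) I u =
      Nat.card {x : K // traceEval F (fun j : I => (α : K) ^ c j) x = u} := by
  refine Nat.card_congr ((Equiv.ofBijective _ (powOrZero_bijective hq hK hα)).subtypeEquiv
    fun i => ?_)
  simp only [cyclicTraceArrayZero_apply, funext_iff]
  rfl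

omit [Finite F] in
/-- The size of the fibres of a surjective linear map. -/
lemma card_fiber_of_surjective {V W : Type*} [AddCommGroup V] [Module F V] [FiniteDimensional F V]
    [AddCommGroup W] [Module F W] (f : V →ₗ[F] W) (hf : Function.Surjective f) (w : W) :
    Nat.card {x // f x = w} = Nat.card F ^ (Module.finrank F V - Module.finrank F W) := by
  obtain ⟨x₀, rfl⟩ := hf w
  have e : {x // f x = f x₀} ≃ LinearMap.ker f :=
    (Equiv.subRight x₀).subtypeEquiv fun x => by simp [sub_eq_zero]
  have h := f.finrank_range_add_finrank_ker
  rw [LinearMap.range_eq_top.2 hf, finrank_top] at h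
  rw [Nat.card_congr e, Module.natCard_eq_pow_finrank (K := F)]
  congr 1
  omega

/-- A surjection from `K` onto `F ^ (t - 1)` has a one-dimensional kernel, so its fibres have
exactly `q` elements. -/
lemma isUniformlyCovered_iff (hq : Nat.card F = q) (ht : 1 ≤ t) (hK : Module.finrank F K = t) {α : Kˣ}
    (hα : IsPrimitiveElement α) {k : ℕ} (c : Fin k ↪ ℕ) (I : Finset (Fin k)) (hI : I.card = t - 1) :
    IsUniformlyCovered q (cyclicTraceArrayZero F q t α c) I ↔
      LinearIndepOn F (fun j => (α : K) ^ c j) (I : Set (Fin k)) := by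
  have hsurj : LinearIndepOn F (fun j => (α : K) ^ c j) (I : Set (Fin k)) ↔
      Function.Surjective (traceEval F fun j : I => (α : K) ^ c j) :=
    traceEval_surjective_iff.symm
  rw [hsurj]
  simp only [IsUniformlyCovered, rowCount_cyclicTraceArrayZero hq hK hα]
  constructor
  · intro h u
    have hq0 : 0 < q := hq ▸ Nat.card_pos
    have : Nonempty {x : K // traceEval F (fun j : I => (α : K) ^ c j) x = u} :=
      (Nat.card_pos_iff.1 ((h u).symm ▸ hq0)).1
    obtain ⟨x, hx⟩ := this
    exact ⟨x, hx⟩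
  · intro h u
    rw [card_fiber_of_surjective _ h, hq, hK, Module.finrank_fintype_fun_eq_card,
      Fintype.card_coe, hI, Nat.sub_sub_self ht, pow_one]

lemma isLinearOrthogonalArray_iff (hq : Nat.card F = q) (ht : 2 ≤ t) (hK : Module.finrank F K = t)
    {α : Kˣ} (hα : IsPrimitiveElement α) {k : ℕ} (c : Fin k ↪ ℕ) (htk : t ≤ k) :
    IsLinearOrthogonalArray q (t - 1) q (cyclicTraceArrayZero F q t α c) ↔
      ∀ I : Finset (Fin k), I.card = t - 1 →
        LinearIndepOn F (fun j => (α : K) ^ c j) (I : Set (Fin k)) := by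
  constructor
  · intro h I hI
    exact (isUniformlyCovered_iff hq (by omega) hK hα c I hI).1 (h.uniformly_covered I hI)
  · intro h
    refine ⟨⟨hq, by omega, by omega, ?_, fun I hI =>
      (isUniformlyCovered_iff hq (by omega) hK hα c I hI).2 (h I hI)⟩,
      LinearMap.range (traceEval F fun j => (α : K) ^ c j), ?_⟩
    · rw [← pow_succ', Nat.sub_add_cancel (by omega)]
    · rw [LinearMap.coe_range, ← (powOrZero_bijective hq hK hα).surjective.range_comp]
      exact congrArg Set.range (funext fun i => funext fun j =>
        (cyclicTraceArrayZero_apply α c i j).symm)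

lemma isIndepSet_leftShift_iff (hq : Nat.card F = q) (ht : 1 ≤ t) (hK : Module.finrank F K = t)
    {α : Kˣ} (hα : IsPrimitiveElement α) {k : ℕ} (c : Fin k ↪ ℕ) (hc : ∀ j, c j ≤ q ^ t - 2)
    (s : ℕ) :
    IsIndepSet F k s (Set.range fun j => leftShift (q ^ t - 1) (c j) (traceSeq F α)) ↔
      IsIndepSet F k s (Set.range fun j => (α : K) ^ c j) := by
  have : Finite K := Module.finite_of_finite F
  let L := traceEval F fun i : Fin (q ^ t - 1) => (α : K) ^ (i : ℕ)
  have hL : LinearMap.ker L = ⊥ := by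
    -- The powers of `α` exhaust the nonzero elements, so an element killed by `L` is
    -- trace-orthogonal to all of `K`.
    refine LinearMap.ker_eq_bot'.2 fun x hx => (traceForm_nondegenerate F K).1 _ fun y => ?_
    rw [Algebra.traceForm_apply]
    by_cases hy : y = 0
    · simp [hy]
    · obtain ⟨n, hn, rfl⟩ := exists_pow_eq hα hy
      rw [orderOf_primitive F hq hK hα] at hn
      exact congrFun hx ⟨n, hn⟩
  have hLc : (fun j => leftShift (q ^ t - 1) (c j) (traceSeq F α)) =
      L ∘ fun j => (α : K) ^ c j := by
    funext j i
    simp [L, leftShift, traceSeq, pow_add, mul_comm]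
  have hinj := injective_pow_of_le hq ht hK hα c hc
  rw [hLc, isIndepSet_range_iff hinj,
    isIndepSet_range_iff ((LinearMap.ker_eq_bot.1 hL).comp hinj)]
  refine and_congr_right' (and_congr_right' (forall₂_congr fun I _ => ?_))
  exact LinearMap.linearIndependent_iff (v := fun j : I => (α : K) ^ c j) L hL

omit [Finite F] [FiniteDimensional F K] in
lemma forall_not_minpoly_dvd_iff (α : K) {k s : ℕ} (c : Fin k → ℕ) :
    (∀ (e : Fin s ↪ Fin k) (d : Fin s → F), d ≠ 0 →
        ¬ minpoly F α ∣ ∑ j, Polynomial.C (d j) * Polynomial.X ^ c (e j)) ↔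
      ∀ I : Finset (Fin k), I.card = s →
        LinearIndepOn F (fun j => α ^ c j) (I : Set (Fin k)) := by
  rw [forall_linearIndepOn_iff_embedding]
  refine forall_congr' fun e => ?_
  rw [Fintype.linearIndependent_iff]
  refine forall_congr' fun d => ?_
  rw [minpoly.dvd_iff, map_sum, ← not_imp_not, not_not, not_not, funext_iff]
  simp [Algebra.smul_def]

omit [Finite F] in
lemma forall_not_mem_flat_iff (ht : 2 ≤ t) (hK : Module.finrank F K = t) (α : Kˣ) {k : ℕ}
    (c : Fin k → ℕ) :
    (∀ I : Finset (Fin k), I.card = t - 1 →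
        ¬ ∃ P : Set (Projectivization F K), IsFlat F ((t : ℤ) - 3) P ∧
          ∀ j ∈ I, powPoint F α (c j) ∈ P) ↔
      ∀ I : Finset (Fin k), I.card = t - 1 →
        LinearIndepOn F (fun j => (α : K) ^ c j) (I : Set (Fin k)) := by
  refine forall₂_congr fun I hI => ?_
  rw [not_iff_comm, not_linearIndepOn_iff_exists_submodule (s := t - 2) _ I (by omega) (by omega)]
  have hmem : ∀ (W : Submodule F K) (n : ℕ),
      (powPoint F α n).submodule ≤ W ↔ (α : K) ^ n ∈ W := fun W n => by
    rw [powPoint, Projectivization.submodule_mk, Submodule.span_singleton_le_iff_mem,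
      Units.val_pow_eq_pow_val]
  constructor
  · rintro ⟨W, hW, h⟩
    exact ⟨_, ⟨W, inferInstance, by omega, rfl⟩, fun j hj => (hmem W _).2 (h j hj)⟩
  · rintro ⟨P, ⟨W, -, hW, rfl⟩, h⟩
    exact ⟨W, by omega, fun j hj => (hmem W _).1 (h j hj)⟩

end Primitive

/-! ## The covering property -/

section Covering

/-- Multiplying by `v ^ (n + 1)` turns `h` into `q - 1` on the right, where Bernoulli's inequality
applies; on the left `q - h ≤ q` is enough. -/
lemma sqrt_pow_mul_lt {q t v h : ℕ} {n : ℕ} (ht : t = n + 2) (hq : 2 ≤ q) (hv : 0 < v)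
    (hvh : v * h = q - 1)
    (H : (q : ℝ) ^ ((t : ℝ) / 2 - 2) * ((q : ℝ) - (t : ℝ) * (v : ℝ)) ≥ (v : ℝ) ^ (t - 1)) :
    (√(q : ℝ)) ^ n * ((q : ℝ) - h) < (h : ℝ) ^ (n + 1) := by
  have hq' : (0 : ℝ) < q := by positivity
  have hv' : (1 : ℝ) ≤ v := by exact_mod_cast hv
  have hvh' : (v : ℝ) * h = q - 1 := by
    rw [← Nat.cast_mul, hvh, Nat.cast_sub (by omega), Nat.cast_one]
  have hs : √(q : ℝ) ^ n * q * (q : ℝ) ^ ((t : ℝ) / 2 - 2) = (q : ℝ) ^ n := by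
    rw [Real.sqrt_eq_rpow, ← Real.rpow_natCast, ← Real.rpow_mul hq'.le, ← Real.rpow_natCast (q : ℝ) n]
    nth_rewrite 2 [← Real.rpow_one (q : ℝ)]
    rw [← Real.rpow_add hq', ← Real.rpow_add hq', ht]
    congr 1
    push_cast
    ring
  have hbern : (q : ℝ) ^ (n + 1) - (n + 1) * (q : ℝ) ^ n ≤ ((q : ℝ) - 1) ^ (n + 1) := by
    have h1 : (1 : ℝ) + (n + 1 : ℕ) * (-1 / q) ≤ (1 + -1 / q) ^ (n + 1) := by
      refine one_add_mul_le_pow ?_ _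
      rw [le_div_iff₀ hq']
      have : (2 : ℝ) ≤ q := by exact_mod_cast hq
      linarith
    have h2 := mul_le_mul_of_nonneg_left h1 (pow_nonneg hq'.le (n + 1))
    rw [← mul_pow, mul_add (q : ℝ) 1, mul_div_cancel₀ _ hq'.ne', pow_succ] at h2
    have h3 : (q : ℝ) ^ n * q * (1 + ((n + 1 : ℕ) : ℝ) * (-1 / q)) =
        (q : ℝ) ^ (n + 1) - (n + 1) * (q : ℝ) ^ n := by
      field_simp
      push_cast
      ring
    rw [mul_one, ← sub_eq_add_neg] at h2
    linarith
  have hvpow : (0 : ℝ) < (v : ℝ) ^ (n + 1) := by positivity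
  refine lt_of_mul_lt_mul_right ?_ hvpow.le
  rw [← mul_pow, mul_comm (h : ℝ), hvh']
  have ht1 : t - 1 = n + 1 := by omega
  rw [ht1] at H
  have hqn : (0 : ℝ) < (q : ℝ) ^ n := by positivity
  calc √(q : ℝ) ^ n * ((q : ℝ) - h) * (v : ℝ) ^ (n + 1)
      ≤ √(q : ℝ) ^ n * q * (v : ℝ) ^ (n + 1) := by
        gcongr
        linarith [Nat.cast_nonneg (α := ℝ) h]
    _ ≤ √(q : ℝ) ^ n * q * ((q : ℝ) ^ ((t : ℝ) / 2 - 2) * ((q : ℝ) - t * v)) := by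
        gcongr
    _ = (q : ℝ) ^ n * ((q : ℝ) - t * v) := by rw [← mul_assoc, hs]
    _ < (q : ℝ) ^ (n + 1) - (n + 1) * (q : ℝ) ^ n := by
        -- Strictness comes from here: `n + 1 < n + 2 = t ≤ t * v`.
        have h4 : (n + 1 : ℝ) < t * v := by
          rw [ht]
          push_cast
          nlinarith
        have := mul_lt_mul_of_pos_left h4 hqn
        rw [pow_succ]
        linarith
    _ ≤ _ := hbern

variable {F K : Type*} [Field F] [Finite F] [Field K] [Algebra F K] [FiniteDimensional F K]

/-- Every tuple of cosets of a large subgroup contains a tuple of traces. -/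
lemma exists_trace_mem_coset (H : Subgroup Fˣ) {n : ℕ}
    (hH : (√(Nat.card F : ℝ)) ^ n * (Nat.card F - Nat.card H : ℝ) < (Nat.card H : ℝ) ^ (n + 1))
    (w : Fin (n + 2) → K) (hw : ∀ i, LinearIndependent F fun j => w (Fin.succAbove i j))
    (g : Fin (n + 2) → Fˣ) :
    ∃ x : K, ∀ i, ∃ h ∈ H, Algebra.trace F K (x * w i) = ((g i * h : Fˣ) : F) := by
  have := Fintype.ofFinite F
  by_cases hli : LinearIndependent F w
  · obtain ⟨x, hx⟩ := traceEval_surjective_iff.2 hli fun i => (g i : F)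
    exact ⟨x, fun i => ⟨1, H.one_mem, by simpa using congrFun hx i⟩⟩
  · obtain ⟨d, hd, i₀, hi₀⟩ := Fintype.not_linearIndependent_iff.1 hli
    -- A vanishing coefficient would leave a nontrivial relation among the other `n + 1` vectors.
    have hd0 : ∀ i, d i ≠ 0 := by
      intro i hi
      rw [Fin.sum_univ_succAbove _ i, hi, zero_smul, zero_add] at hd
      have := Fintype.linearIndependent_iff.1 (hw i) _ hd
      rcases Fin.eq_self_or_eq_succAbove i i₀ with rfl | ⟨j, rfl⟩
      · exact hi₀ hi
      · exact hi₀ (this j)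
    obtain ⟨h, hh⟩ := exists_sum_mul_mem_eq_zero H (fun i => Units.mk0 (d i) (hd0 i) * g i) hH
    -- All traces but the one at index `0` can be prescribed; that one is then forced by the
    -- relation, and `hh` puts it in the right coset.
    obtain ⟨x, hx⟩ := traceEval_surjective_iff.2 (hw 0) fun j =>
      ((g (Fin.succAbove 0 j) * h (Fin.succAbove 0 j) : Fˣ) : F)
    have hx' : ∀ j, Algebra.trace F K (x * w (Fin.succ j)) = ((g j.succ * h j.succ : Fˣ) : F) :=
      fun j => congrFun hx j
    refine ⟨x, fun i => ⟨h i, (h i).2, ?_⟩⟩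
    refine Fin.cases ?_ hx' i
    have h1 := sum_mul_trace_mul d w x
    rw [hd, mul_zero, map_zero, Fin.sum_univ_succ] at h1
    rw [Fin.sum_univ_succ] at hh
    simp only [Units.val_mul, Units.val_mk0, hx', mul_assoc] at h1 hh
    exact mul_left_cancel₀ (hd0 0) (by
      rw [Units.val_mul]
      linear_combination h1 - hh)

variable {q t : ℕ}

-- The norm is the power map with exponent `[t]_q`, so the base `ω` of the logarithm is the image of
-- an element of `F`.
omit [Finite F] [FiniteDimensional F K] in
lemma algebraMap_norm_primitive [Finite K] (hq : Nat.card F = q) (hK : Module.finrank F K = t)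
    (α : Kˣ) : algebraMap F K (Units.map (Algebra.norm F) α : Fˣ) = (α : K) ^ qNumber q t := by
  have := Module.natCard_eq_pow_finrank (K := F) (V := K)
  rw [Units.coe_map, FiniteField.algebraMap_norm_eq_pow, this, hq, hK, qNumber]

omit [Finite F] [FiniteDimensional F K] in
lemma orderOf_norm_primitive [Finite K] (hq : Nat.card F = q) {α : Kˣ}
    (hα : IsPrimitiveElement α) :
    orderOf (Units.map (Algebra.norm F) α : Fˣ) = q - 1 := by
  rw [orderOf_eq_card_of_forall_mem_zpowers, Nat.card_units, hq]
  intro y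
  obtain ⟨x, rfl⟩ := FiniteField.unitsMap_norm_surjective F K y
  obtain ⟨n, rfl⟩ := hα x
  exact ⟨n, by simp⟩

-- Exponents of the norm of `α` are determined modulo `q - 1`, hence modulo its divisor `v`.
omit [Finite F] [FiniteDimensional F K] in
lemma discreteLog_mod [Finite K] (hq : Nat.card F = q) (hK : Module.finrank F K = t) {α : Kˣ}
    (hα : IsPrimitiveElement α) {v : ℕ} (hv : v ∣ q - 1) (a : ℕ) :
    discreteLog ((α : K) ^ qNumber q t)
      (algebraMap F K ((Units.map (Algebra.norm F) α ^ a : Fˣ) : F)) ≡ a [MOD v] := by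
  set β : Fˣ := Units.map (Algebra.norm F) α with hβ
  have hne : {i : ℕ | ((α : K) ^ qNumber q t) ^ i = algebraMap F K ((β ^ a : Fˣ) : F)}.Nonempty :=
    ⟨a, by simp [hβ, ← algebraMap_norm_primitive hq hK]⟩
  have hmem := Nat.sInf_mem hne
  change _ ^ discreteLog _ _ = _ at hmem
  nth_rewrite 1 [← algebraMap_norm_primitive hq hK] at hmem
  rw [← map_pow, ← Units.val_pow_eq_pow_val] at hmem
  have h := Units.ext ((algebraMap F K).injective hmem)
  rw [pow_eq_pow_iff_modEq, orderOf_norm_primitive hq hα] at h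
  exact h.of_dvd hv

lemma pow_pred_le_qNumber (hq : 2 ≤ q) (ht : 1 ≤ t) : q ^ (t - 1) ≤ qNumber q t := by
  rw [qNumber, Nat.le_div_iff_mul_le (by omega), Nat.mul_sub, mul_one, ← pow_succ,
    Nat.sub_add_cancel ht]
  exact Nat.sub_le_sub_left (Nat.one_le_pow _ _ (by omega)) _

lemma isCoveringArray_cyclicTraceArrayMod (hq : Nat.card F = q) (ht : 2 ≤ t)
    (hK : Module.finrank F K = t) {α : Kˣ} (hα : IsPrimitiveElement α) {v k : ℕ} [NeZero v]
    (hv : v ∣ q - 1) (c : Fin k ↪ ℕ) (htk : t ≤ k)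
    (hindep : ∀ I : Finset (Fin k), I.card = t - 1 →
      LinearIndepOn F (fun j => (α : K) ^ c j) (I : Set (Fin k)))
    (hqv : (q : ℝ) ^ ((t : ℝ) / 2 - 2) * ((q : ℝ) - (t : ℝ) * (v : ℝ)) ≥ (v : ℝ) ^ (t - 1)) :
    IsCoveringArray 1 t v (cyclicTraceArrayMod F q t v α c) := by
  have : Finite K := Module.finite_of_finite F
  have hq2 : 2 ≤ q := hq ▸ Finite.one_lt_card
  have hvpos : 0 < v := Nat.pos_of_ne_zero (NeZero.ne v)
  have hvq : v ≤ q := (Nat.le_of_dvd (by omega) hv).trans (Nat.sub_le _ _)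
  refine ⟨Nat.card_fin v, le_rfl, by omega, htk, ?_, fun I hI u => ?_⟩
  · rw [one_mul]
    calc v ^ t = v * v ^ (t - 1) := by rw [← pow_succ', Nat.sub_add_cancel (by omega)]
      _ ≤ v * q ^ (t - 1) := by gcongr
      _ ≤ v * qNumber q t := by gcongr; exact pow_pred_le_qNumber hq2 (by omega)
  obtain ⟨n, rfl⟩ := Nat.exists_eq_add_of_le' ht
  set β : Fˣ := Units.map (Algebra.norm F) α with hβ
  have hord : orderOf β = q - 1 := orderOf_norm_primitive hq hα
  let e := I.orderIsoOfFin hI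
  have hcard : v * Nat.card (Subgroup.zpowers (β ^ v)) = q - 1 := by
    rw [Nat.card_zpowers, orderOf_pow_of_dvd hvpos.ne' (hord ▸ hv), hord, Nat.mul_div_cancel' hv]
  have hH := sqrt_pow_mul_lt rfl hq2 hvpos hcard hqv
  rw [← hq] at hH
  obtain ⟨x, hx⟩ := exists_trace_mem_coset _ hH (fun i => (α : K) ^ c (e i))
    (fun i => (forall_linearIndepOn_iff_embedding _).1 hindep
      ((Fin.succAboveEmb i).trans (e.toEquiv.toEmbedding.trans (Function.Embedding.subtype _))))
    (fun i => β ^ (u (e i) : ℕ))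
  have hx0 : x ≠ 0 := by
    rintro rfl
    obtain ⟨h, -, hh⟩ := hx 0
    rw [zero_mul, map_zero] at hh
    exact (Units.ne_zero _ hh.symm)
  obtain ⟨m, -, rfl⟩ := exists_pow_eq hα hx0
  have hQ : 0 < v * qNumber q (n + 2) :=
    Nat.mul_pos hvpos ((by positivity : 0 < q ^ (n + 1)).trans_le
      (pow_pred_le_qNumber (t := n + 2) hq2 (by omega)))
  refine Nat.card_pos_iff.2 ⟨⟨⟨m % (v * qNumber q (n + 2)), Nat.mod_lt _ hQ⟩, fun j => ?_⟩,
    inferInstance⟩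
  obtain ⟨h, hh, htr⟩ := hx (e.symm j)
  simp only [OrderIso.apply_symm_apply] at htr
  -- Since `α ^ (v * [t]_q)` is the image of `β ^ v`, reducing the exponent `m` divides the trace by
  -- a power of `β ^ v`, which stays in the same coset.
  obtain ⟨r, hr⟩ : ∃ r : ℕ, Algebra.trace F K ((α : K) ^ (m % (v * qNumber q (n + 2)) + c j)) =
      ((β ^ ((u j : ℕ) + v * r) : Fˣ) : F) := by
    set s := m / (v * qNumber q (n + 2))
    have hmem : h * (β ^ v)⁻¹ ^ s ∈ Subgroup.zpowers (β ^ v) :=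
      mul_mem hh (pow_mem (inv_mem (Subgroup.mem_zpowers _)) _)
    obtain ⟨r, hr⟩ := mem_powers_iff_mem_zpowers.2 hmem
    refine ⟨r, ?_⟩
    have hpow : (α : K) ^ m * (α : K) ^ c j =
        (((β ^ v) ^ s : Fˣ) : F) • (α : K) ^ (m % (v * qNumber q (n + 2)) + c j) := by
      rw [Algebra.smul_def, Units.val_pow_eq_pow_val, Units.val_pow_eq_pow_val, map_pow, map_pow,
        algebraMap_norm_primitive hq hK, ← pow_mul, ← pow_mul, ← pow_add, ← pow_add]
      congr 1
      have : m % (v * qNumber q (n + 2)) + v * qNumber q (n + 2) * s = m := Nat.mod_add_div _ _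
      rw [← mul_assoc, mul_comm (qNumber q (n + 2)) v]
      omega
    rw [hpow, map_smul, smul_eq_mul] at htr
    refine mul_left_cancel₀ (Units.ne_zero ((β ^ v) ^ s)) (htr.trans ?_)
    rw [← Units.val_mul, pow_add, pow_mul]
    simp only at hr
    rw [hr]
    congr 1
    rw [inv_pow, mul_left_comm, mul_comm h, mul_inv_cancel_left]
  simp only [cyclicTraceArrayMod, Matrix.of_apply]
  rw [if_pos (by rw [hr]; exact Units.ne_zero _), hr]
  ext
  have := discreteLog_mod hq hK hα hv ((u j : ℕ) + v * r)
  rw [Fin.val_ofNat]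
  refine Eq.trans this ?_
  rw [Nat.add_mul_mod_self_left, Nat.mod_eq_of_lt (u j).2]

end Covering

end CyclicTrace

/-! ### The theorem: all five conditions reduce to independence of the chosen powers of `α` -/

theorem mainTheorem1 {F K : Type*} [Field F] [Finite F] [Field K] [Algebra F K]
    (q t v k : ℕ) [NeZero v]
    (hq : Nat.card F = q) (ht : 2 ≤ t) (hK : Module.finrank F K = t)
    (α : Kˣ) (hα : CyclicTrace.IsPrimitiveElement α)
    (hv : v ∣ q - 1)
    (c : Fin k ↪ ℕ) (hc : ∀ j, c j ≤ q ^ t - 2) (htk : t ≤ k) :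
    List.TFAE [
      CyclicTrace.IsLinearOrthogonalArray q (t - 1) q
        (CyclicTrace.cyclicTraceArrayZero F q t α c),
      CyclicTrace.IsIndepSet F k (t - 1) (Set.range fun j => (α : K) ^ c j),
      CyclicTrace.IsIndepSet F k (t - 1)
        (Set.range fun j => CyclicTrace.leftShift (q ^ t - 1) (c j) (CyclicTrace.traceSeq F α)),
      ∀ (e : Fin (t - 1) ↪ Fin k) (d : Fin (t - 1) → F), d ≠ 0 →
        ¬ minpoly F (α : K) ∣ ∑ j, Polynomial.C (d j) * Polynomial.X ^ c (e j),
      ∀ I : Finset (Fin k), I.card = t - 1 →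
        ¬ ∃ P : Set (Projectivization F K), CyclicTrace.IsFlat F ((t : ℤ) - 3) P ∧
          ∀ j ∈ I, CyclicTrace.powPoint F α (c j) ∈ P] ∧
    (CyclicTrace.IsIndepSet F k (t - 1) (Set.range fun j => (α : K) ^ c j) →
      (q : ℝ) ^ ((t : ℝ) / 2 - 2) * ((q : ℝ) - (t : ℝ) * (v : ℝ)) ≥ (v : ℝ) ^ (t - 1) →
      CyclicTrace.IsCoveringArray 1 t v (CyclicTrace.cyclicTraceArrayMod F q t v α c)) := by
  have hfin : FiniteDimensional F K := Module.finite_of_finrank_pos (by omega)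
  have hset : CyclicTrace.IsIndepSet F k (t - 1) (Set.range fun j => (α : K) ^ c j) ↔
      ∀ I : Finset (Fin k), I.card = t - 1 →
        LinearIndepOn F (fun j => (α : K) ^ c j) (I : Set (Fin k)) := by
    rw [CyclicTrace.isIndepSet_range_iff
      (CyclicTrace.injective_pow_of_le hq (by omega) hK hα c hc)]
    exact ⟨fun h => h.2.2, fun h => ⟨by omega, by omega, h⟩⟩
  refine ⟨?_, fun h hqv => CyclicTrace.isCoveringArray_cyclicTraceArrayMod hq ht hK hα hv c htk
    (hset.1 h) hqv⟩
  rw [CyclicTrace.isLinearOrthogonalArray_iff hq ht hK hα c htk,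
    CyclicTrace.isIndepSet_leftShift_iff hq (by omega) hK hα c hc,
    CyclicTrace.forall_not_minpoly_dvd_iff, CyclicTrace.forall_not_mem_flat_iff ht hK α c, hset]
  simp
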